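/- **Model.** A communication network is a graph whose vertices are processors with distinct IDs from $\{1,\dots,N\}$; each vertex distinguishes its incident edges by port numbers. Computation proceeds in synchronous rounds $0,1,2,\dots$ of a global clock. In each round a vertex is either awake or asleep. An awake vertex may send a message of arbitrary size through each of its ports, receives the messages that its awake neighbours send to it in that round, and updates its state by an arbitrary local computation. A sleeping vertex sends and receives nothing (messages sent to it are lost) and does not change its state; whether it is awake in a round is determined by its current state and the number of the round, hence was decided in its last awake round or is hard-coded. The initial state of a vertex depends on its ID and its degree; the algorithm may depend on the number $n$ of vertices, on $N$, and on the number $t$ of clock rounds. The (worst-case) awake complexity of an execution of $t$ clock rounds is the maximum over all vertices of the number of rounds, among these $t$, in which the vertex is awake. **Problem.** A *distributed layered tree* (DLT) of a graph is a rooted spanning tree of it, oriented towards the root, together with labels of the vertices in a linearly ordered set, such that the label of every non-root vertex is greater than that of its parent. In the DLT problem every vertex must output its own label and either declare itself the root or output the port leading to its parent together with the label of its parent. **Theorem.** There are an absolute constant $c>0$ and a function $R:\mathbb N\to\mathbb N$ such that the following holds for all integers $t\ge 0$, $n\ge 3$ and $N\ge\max\{n,R(t)\}$. Let $\mathcal A$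 be any deterministic algorithm that solves the DLT problem in $t$ clock rounds for all assignments of distinct IDs from $\{1,\dots,N\}$; it suffices that it does so on the $n$-vertex cycle with consistently oriented ports (at every vertex, port $0$ leads to the successor and port $1$ to the predecessor). Then there is an assignment of distinct IDs from $\{1,\dots,N\}$ to the vertices of this cycle for which the execution of $\mathcal A$ has awake complexity at least $c\log n$. -/

import Mathlib

namespace SleepingModel

/-- A port numbering of a graph: port `i` of the vertex `v` leads to the `i`-th entry of
`nbrs v`, a repetition-free list of all neighbours of `v`. -/
structure PortNumbering {V : Type} (G : SimpleGraph V) where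
  nbrs : V → List V
  nodup : ∀ v, (nbrs v).Nodup
  mem_iff : ∀ v w, w ∈ nbrs v ↔ G.Adj v w

/-- What a vertex outputs: its own label and, unless it declares itself the root, the port
that leads to its parent together with the label of that parent. -/
structure DLTOutput (Λ : Type) where
  label : Λ
  parent : Option (ℕ × Λ)

/-- The vertex at the other end of the port that `v` names as leading to its parent. -/
def parentOf {V : Type} {G : SimpleGraph V} {Λ : Type} (P : PortNumbering G)
    (out : V → DLTOutput Λ) (v : V) : Option V :=
  (out v).parent.bind fun p => (P.nbrs v)[p.1]?

/-- The outputs of the vertices form a distributed layered tree: a rooted labelled spanning tree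
of `G`, given by parent pointers, in which every label exceeds the label of the parent and every
vertex knows the label of its parent. -/
structure IsDLT {V : Type} {G : SimpleGraph V} {Λ : Type} [LinearOrder Λ]
    (P : PortNumbering G) (out : V → DLTOutput Λ) : Prop where
  /-- exactly one vertex declares itself the root -/
  root : ∃! r, (out r).parent = none
  /-- every named parent port is a port of the vertex -/
  port_valid : ∀ v p, (out v).parent = some p → p.1 < (P.nbrs v).length
  /-- the edges between vertices and their parents form a spanning tree -/
  tree : (SimpleGraph.fromRel fun v w => parentOf P out v = some w).IsTree
  /-- labels increase from parent to child -/
  label_lt : ∀ v w, parentOf P out v = some w → (out w).label < (out v).label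
  /-- every vertex knows the label of its parent -/
  knows : ∀ v w p, parentOf P out v = some w → (out v).parent = some p → p.2 = (out w).label

/-- A deterministic distributed algorithm in the sleeping model, with output labels in `Λ`.
There is no restriction on local computation or on message size. In rounds in which a vertex
sleeps its state is frozen, so that `awake` applied to the current state and the number of the
round is a decision taken in the last awake round (or hard-coded, if there was none). -/
structure Algorithm (Λ : Type) where
  State : Type
  Msg : Type
  /-- the initial state, from the ID and the degree of the vertex -/
  init : ℕ → ℕ → State
  /-- is a vertex with this state awake in the given round? -/
  awake : State → ℕ → Bool
  /-- the message (if any) sent in the given round through the given port -/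
  send : State → (round port : ℕ) → Option Msg
  /-- the new state, from the old state, the round, and what arrives through ports `0, 1, …` -/
  receive : State → (round : ℕ) → List (Option Msg) → State
  output : State → DLTOutput Λ

namespace Algorithm

variable {V : Type} [DecidableEq V] {G : SimpleGraph V} {Λ : Type}

/-- `A.state P ident k v` is the state of `v` after the rounds `0, …, k - 1`, when all vertices
run `A` with the IDs `ident`. Only awake vertices send, receive, and change their state. -/
def state (A : Algorithm Λ) (P : PortNumbering G) (ident : V → ℕ) : ℕ → V → A.State
  | 0, v => A.init (ident v) (P.nbrs v).length
  | k + 1, v =>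
    if A.awake (state A P ident k v) k then
      A.receive (state A P ident k v) k
        ((P.nbrs v).map fun w =>
          if A.awake (state A P ident k w) k then
            A.send (state A P ident k w) k ((P.nbrs w).idxOf v)
          else none)
    else state A P ident k v

/-- The number of the rounds `0, …, t - 1` in which `v` is awake. -/
def awakeRounds (A : Algorithm Λ) (P : PortNumbering G) (ident : V → ℕ) (t : ℕ) (v : V) : ℕ :=
  ((Finset.range t).filter fun k => A.awake (A.state P ident k v) k = true).card

/-- The worst-case awake complexity of the `t`-round execution: the maximum over all vertices of
the number of awake rounds. -/
def awakeComplexity [Fintype V] (A : Algorithm Λ) (P : PortNumbering G) (ident : V → ℕ)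
    (t : ℕ) : ℕ :=
  Finset.univ.sup (A.awakeRounds P ident t)

end Algorithm

/-- The IDs are distinct and belong to `{1, …, N}`. -/
def IsIDAssignment {V : Type} (N : ℕ) (ident : V → ℕ) : Prop :=
  Function.Injective ident ∧ ∀ v, ident v ∈ Set.Icc 1 N

/-- On the graph with port numbering `P`, for every assignment of IDs from `{1, …, N}`,
the outputs of `A` after `t` clock rounds form a distributed layered tree. -/
def Algorithm.SolvesDLT {V : Type} [DecidableEq V] {G : SimpleGraph V} {Λ : Type} [LinearOrder Λ]
    (A : Algorithm Λ) (P : PortNumbering G) (N t : ℕ) : Prop :=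
  ∀ ident : V → ℕ, IsIDAssignment N ident →
    IsDLT P fun v => A.output (A.state P ident t v)

/-- The `n`-vertex cycle with consistently oriented ports: port `0` leads to the successor,
port `1` to the predecessor. -/
def orientedCycle (n : ℕ) (hn : 3 ≤ n) : PortNumbering (SimpleGraph.cycleGraph n) where
  nbrs v := [finRotate n v, (finRotate n).symm v]
  nodup v := by
    obtain ⟨m, rfl⟩ : ∃ m, n = m + 3 := ⟨n - 3, by omega⟩
    have h : finRotate (m + 3) v ≠ (finRotate (m + 3)).symm v := by
      intro h
      have h2 : finRotate (m + 3) (finRotate (m + 3) v) = v := by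
        rw [h, Equiv.apply_symm_apply]
      rw [finRotate_apply, finRotate_apply, add_assoc, add_eq_left] at h2
      have h3 := congrArg Fin.val h2
      rw [Fin.val_add, Fin.val_one, Fin.val_zero, Nat.mod_eq_of_lt (by omega)] at h3
      omega
    simpa using h
  mem_iff v w := by
    obtain ⟨m, rfl⟩ : ∃ m, n = m + 3 := ⟨n - 3, by omega⟩
    have h : w = (finRotate (m + 3)).symm v ↔ v = w + 1 := by
      rw [Equiv.eq_symm_apply, finRotate_apply, eq_comm]
    rw [List.mem_cons, List.mem_singleton, h, finRotate_apply,
      SimpleGraph.cycleGraph_adj, sub_eq_iff_eq_add, sub_eq_iff_eq_add]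
    rw [add_comm 1 w, add_comm 1 v]
    exact or_comm

end SleepingModel

namespace SleepingModel

variable {Λ : Type}

/-! A vertex that is rarely awake learns little about its surroundings, and an adversary can choose
the IDs so that it learns as little as possible. A level-`j` segment is a block of `3 ^ j` IDs for
which the centre's behaviour is independent of the context until it has been awake `j` times and is
about to wake again, or until time `t`. Given three disjoint level-`j` segments, place the one with
the earliest horizon in the middle: up to that horizon both outer centres are determined and shield
everything between them. So the middle centre's next awake round is determined too, which gives
level `j + 1` (`Algorithm.IsSegment.concat`, `Algorithm.exists_isSegment`).

If some level-`j` segment has a horizon before `t`, its centre is awake more than `j` times.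
Otherwise the centres of six disjoint segments have outputs independent of context, while any three
of them can be placed on the cycle in any order. At most one of the six is a root, so three point in
the same direction. Arrange these so that labels do not decrease in that direction. Pointers descend
in label, so each of the two gaps contains a root, contradicting uniqueness
(`not_forall_exists_lineDLT`). Taking `3 ^ j` proportional to `n` gives the logarithm. -/

/-- The execution of `A` on the bi-infinite oriented path with IDs `x`. -/
def Algorithm.lineState (A : Algorithm Λ) (x : ℤ → ℕ) : ℕ → ℤ → A.State
  | 0, i => A.init (x i) 2
  | k + 1, i =>
    if A.awake (lineState A x k i) k then
      A.receive (lineState A x k i) k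
        [if A.awake (lineState A x k (i + 1)) k then A.send (lineState A x k (i + 1)) k 1 else none,
         if A.awake (lineState A x k (i - 1)) k then A.send (lineState A x k (i - 1)) k 0 else none]
    else lineState A x k i

/-- The IDs `x` around the position `i` agree with the IDs `s` around `0` up to distance `r`. -/
def Matches (x : ℤ → ℕ) (i : ℤ) (s : ℤ → ℕ) (r : ℤ) : Prop :=
  ∀ m, -r ≤ m → m ≤ r → x (i + m) = s m

/-- The segment of radius `r` around `0` in `s` determines the states of its centre up to round
`T`, whatever the IDs outside the segment are, and either `T = t` or round `T` is an awake round
of the centre that is preceded by at least `j` awake rounds. -/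
structure Algorithm.IsSegment (A : Algorithm Λ) (t j : ℕ) (r : ℤ) (s : ℤ → ℕ) (T : ℕ) : Prop where
  le : T ≤ t
  det : ∀ x i, Matches x i s r → ∀ k ≤ T, A.lineState x k i = A.lineState s k 0
  awake : T = t ∨ (A.awake (A.lineState s T 0) T = true ∧
    j ≤ ((Finset.range T).filter fun k => A.awake (A.lineState s k 0) k = true).card)

/-- The concatenation of three segments of radius `r`. -/
def concat (r : ℤ) (a b c : ℤ → ℕ) (m : ℤ) : ℕ :=
  if m < -r then a (m + (2 * r + 1)) else if m ≤ r then b m else c (m - (2 * r + 1))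

/-! ### Concatenating three segments -/

section Concat

variable {x a b c : ℤ → ℕ} {i r : ℤ}

theorem Matches.left (h : Matches x i (concat r a b c) (3 * r + 1)) :
    Matches x (i - (2 * r + 1)) a r := by
  intro m h1 h2
  have := h (m - (2 * r + 1)) (by omega) (by omega)
  rw [concat, if_pos (by omega)] at this
  rw [show i - (2 * r + 1) + m = i + (m - (2 * r + 1)) by ring, this]
  congr 1; ring

theorem Matches.middle (h : Matches x i (concat r a b c) (3 * r + 1)) :
    Matches x i b r := by
  intro m h1 h2
  have := h m (by omega) (by omega)
  rwa [concat, if_neg (by omega), if_pos (by omega)] at this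

theorem Matches.right (h : Matches x i (concat r a b c) (3 * r + 1)) :
    Matches x (i + (2 * r + 1)) c r := by
  intro m h1 h2
  have := h (m + (2 * r + 1)) (by omega) (by omega)
  rw [concat, if_neg (by omega), if_neg (by omega)] at this
  rw [show i + (2 * r + 1) + m = i + (m + (2 * r + 1)) by ring, this]
  congr 1; ring

theorem Matches.refl (s : ℤ → ℕ) (r : ℤ) : Matches s 0 s r := fun m _ _ => by rw [zero_add]

theorem injOn_concat {S : Fin 3 → Set ℕ} (hS : Pairwise fun p q => Disjoint (S p) (S q))
    (ha : Set.InjOn a (Set.Icc (-r) r)) (hb : Set.InjOn b (Set.Icc (-r) r))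
    (hc : Set.InjOn c (Set.Icc (-r) r)) (hA : Set.MapsTo a (Set.Icc (-r) r) (S 0))
    (hB : Set.MapsTo b (Set.Icc (-r) r) (S 1)) (hC : Set.MapsTo c (Set.Icc (-r) r) (S 2)) :
    Set.InjOn (concat r a b c) (Set.Icc (-(3 * r + 1)) (3 * r + 1)) := by
  -- The offset `p.val - 1` is an integer, so the three blocks are shifted by -1, 0 and 1 block
  -- lengths.
  have key : ∀ m ∈ Set.Icc (-(3 * r + 1)) (3 * r + 1), ∃ p : Fin 3,
      ∃ m' ∈ Set.Icc (-r) r, m = m' + (p.val - 1) * (2 * r + 1) ∧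
        concat r a b c m = (![a, b, c] p) m' := by
    rintro m ⟨h1, h2⟩
    by_cases h3 : m < -r
    · refine ⟨0, m + (2 * r + 1), ⟨by omega, by omega⟩, by simp; ring, ?_⟩
      rw [concat, if_pos h3]; rfl
    by_cases h4 : m ≤ r
    · refine ⟨1, m, ⟨by omega, by omega⟩, by simp, ?_⟩
      rw [concat, if_neg h3, if_pos h4]; rfl
    · refine ⟨2, m - (2 * r + 1), ⟨by omega, by omega⟩, by simp, ?_⟩
      rw [concat, if_neg h3, if_neg h4]; rfl
  have inj : ∀ p, Set.InjOn (![a, b, c] p) (Set.Icc (-r) r) := by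
    intro p; fin_cases p <;> assumption
  have maps : ∀ p, Set.MapsTo (![a, b, c] p) (Set.Icc (-r) r) (S p) := by
    intro p; fin_cases p <;> assumption
  intro m hm n hn hmn
  obtain ⟨p, m', hm', e1, e2⟩ := key m hm
  obtain ⟨q, n', hn', e3, e4⟩ := key n hn
  have hpq : p = q := by
    by_contra hpq
    refine Set.disjoint_left.1 (hS hpq) (maps p hm') ?_
    rw [← e2, hmn, e4]
    exact maps q hn'
  subst hpq
  rw [e2, e4] at hmn
  rw [e1, e3, inj p hm' hn' hmn]

theorem mapsTo_concat {S : Set ℕ} (hA : Set.MapsTo a (Set.Icc (-r) r) S)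
    (hB : Set.MapsTo b (Set.Icc (-r) r) S) (hC : Set.MapsTo c (Set.Icc (-r) r) S) :
    Set.MapsTo (concat r a b c) (Set.Icc (-(3 * r + 1)) (3 * r + 1)) S := by
  rintro m ⟨h1, h2⟩
  unfold concat
  split_ifs with h3 h4
  · exact hA ⟨by omega, by omega⟩
  · exact hB ⟨by omega, by omega⟩
  · exact hC ⟨by omega, by omega⟩

end Concat

/-- From `a` on, `p` fails until it first holds or the time `t` is reached. -/
theorem exists_first_or_end (p : ℕ → Bool) {a t : ℕ} (h : a ≤ t) :
    ∃ T, a ≤ T ∧ T ≤ t ∧ (∀ k, a ≤ k → k < T → p k = false) ∧ (T = t ∨ p T = true) := by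
  by_cases hp : ∃ k, a ≤ k ∧ k < t ∧ p k = true
  · classical
    have hs := Nat.find_spec hp
    refine ⟨Nat.find hp, hs.1, hs.2.1.le, fun k h1 h2 => ?_, Or.inr hs.2.2⟩
    have := Nat.find_min hp h2
    by_contra hk
    exact this ⟨h1, h2.trans hs.2.1, by simpa using hk⟩
  · push Not at hp
    exact ⟨t, h, le_rfl, fun k h1 h2 => by simpa using hp k h1 h2, Or.inl rfl⟩

/-! ### Building segments on the infinite path -/

section Line

variable (A : Algorithm Λ)

theorem Algorithm.lineState_succ_of_asleep {x : ℤ → ℕ} {k : ℕ} {i : ℤ}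
    (h : A.awake (A.lineState x k i) k = false) :
    A.lineState x (k + 1) i = A.lineState x k i := by
  rw [lineState, if_neg (by simp [h])]

theorem Algorithm.lineState_succ_congr {x y : ℤ → ℕ} {k : ℕ} {i i' : ℤ}
    (h0 : A.lineState x k i = A.lineState y k i')
    (h1 : A.lineState x k (i + 1) = A.lineState y k (i' + 1))
    (h2 : A.lineState x k (i - 1) = A.lineState y k (i' - 1)) :
    A.lineState x (k + 1) i = A.lineState y (k + 1) i' := by
  rw [lineState, lineState, h0, h1, h2]

/-- Equal states stay equal as long as the vertex sleeps. -/
theorem Algorithm.lineState_eq_of_asleep {x y : ℤ → ℕ} {i i' : ℤ} {a T : ℕ}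
    (h0 : A.lineState x a i = A.lineState y a i')
    (h : ∀ k, a ≤ k → k < T → A.awake (A.lineState y k i') k = false) :
    ∀ k, a ≤ k → k ≤ T → A.lineState x k i = A.lineState y k i' := by
  intro k hk
  induction k, hk using Nat.le_induction with
  | base => exact fun _ => h0
  | succ k hk ih =>
    intro hT
    have e := ih (by omega)
    have hs := h k hk (by omega)
    rw [A.lineState_succ_of_asleep hs, A.lineState_succ_of_asleep (by rw [e, hs]), e]

/-- A sleeping vertex receives nothing, so its own ID fixes its state until it first wakes. -/
theorem Algorithm.exists_isSegment_zero (t : ℕ) (s : ℤ → ℕ) : ∃ T, A.IsSegment t 0 0 s T := by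
  obtain ⟨T, -, hT, h1, h2⟩ :=
    exists_first_or_end (fun k => A.awake (A.lineState s k 0) k) (Nat.zero_le t)
  refine ⟨T, hT, fun x i hx k hk => ?_, h2.imp_right fun h => ⟨h, Nat.zero_le _⟩⟩
  refine A.lineState_eq_of_asleep (a := 0) ?_ h1 k (Nat.zero_le k) hk
  have := hx 0 le_rfl le_rfl
  rw [add_zero] at this
  rw [lineState, lineState, this]

/-- If the middle one of three segments is the first to reach its last determined round, then the
concatenation determines one more awake round of its centre. -/
theorem Algorithm.IsSegment.concat {A : Algorithm Λ} {t j : ℕ} {r : ℤ} (hr : 0 ≤ r)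
    {a b c : ℤ → ℕ} {Ta Tb Tc : ℕ} (ha : A.IsSegment t j r a Ta) (hb : A.IsSegment t j r b Tb)
    (hc : A.IsSegment t j r c Tc) (hab : Tb ≤ Ta) (hcb : Tb ≤ Tc) :
    ∃ T, A.IsSegment t (j + 1) (3 * r + 1) (concat r a b c) T := by
  set s := SleepingModel.concat r a b c with hs
  have hss : Matches s 0 s (3 * r + 1) := Matches.refl s _
  have mid : ∀ x i, Matches x i s (3 * r + 1) → ∀ k ≤ Tb,
      A.lineState x k i = A.lineState s k 0 := fun x i hx k hk =>
    (hb.det x i (hx.middle) k hk).trans (hb.det s 0 (hss.middle) k hk).symm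
  rcases hb.awake with hT | ⟨haw, hcard⟩
  · exact ⟨Tb, hb.le, mid, Or.inl hT⟩
  rcases hb.le.eq_or_lt with hT | hlt
  · exact ⟨Tb, hb.le, mid, Or.inl hT⟩
  -- Induction on rounds over the window between the two outer centres. The window's ends are
  -- determined by their own segments, since `Tb ≤ Ta` and `Tb ≤ Tc`; interior vertices update from
  -- neighbours inside the window.
  have loc : ∀ x i, Matches x i s (3 * r + 1) → ∀ k ≤ Tb, ∀ d, -(2 * r + 1) ≤ d → d ≤ 2 * r + 1 →
      A.lineState x k (i + d) = A.lineState s k (0 + d) := by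
    intro x i hx k
    induction k with
    | zero =>
      intro _ d h1 h2
      rw [lineState, lineState, hx d (by omega) (by omega), zero_add]
    | succ k ih =>
      intro hk d h1 h2
      have ih := ih (by omega)
      rcases h1.eq_or_lt with rfl | h1
      · exact (ha.det x _ (hx.left) _ (by omega)).trans
          (ha.det s _ (hss.left) _ (by omega)).symm
      rcases h2.eq_or_lt with rfl | h2
      · exact (hc.det x _ (hx.right) _ (by omega)).trans
          (hc.det s _ (hss.right) _ (by omega)).symm
      refine A.lineState_succ_congr (ih d (by omega) (by omega)) ?_ ?_
      · rw [add_assoc, add_assoc]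
        exact ih (d + 1) (by omega) (by omega)
      · rw [add_sub_assoc, add_sub_assoc]
        exact ih (d - 1) (by omega) (by omega)
  have next : ∀ x i, Matches x i s (3 * r + 1) →
      A.lineState x (Tb + 1) i = A.lineState s (Tb + 1) 0 := fun x i hx =>
    A.lineState_succ_congr (mid x i hx _ le_rfl)
      (loc x i hx _ le_rfl 1 (by omega) (by omega))
      (loc x i hx _ le_rfl (-1) (by omega) (by omega))
  -- The state after round `Tb` is now determined, and it stays frozen until the next awake round
  -- `T`. Round `Tb` itself is the additional awake round counted below.
  obtain ⟨T, h1, h2, h3, h4⟩ :=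
    exists_first_or_end (fun k => A.awake (A.lineState s k 0) k) (Nat.succ_le_of_lt hlt)
  have hsb : ∀ k ≤ Tb, A.lineState s k 0 = A.lineState b k 0 :=
    hb.det s 0 (hss.middle)
  refine ⟨T, h2, fun x i hx k hk => ?_, h4.imp_right fun h => ⟨h, ?_⟩⟩
  · rcases le_or_gt k Tb with hkb | hkb
    · exact mid x i hx k hkb
    · exact A.lineState_eq_of_asleep (next x i hx) h3 k hkb hk
  · refine (Nat.succ_le_succ hcard).trans ?_
    have hnot : Tb ∉ (Finset.range Tb).filter
        fun k => A.awake (A.lineState b k 0) k = true := by simp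
    rw [Nat.succ_eq_add_one, ← Finset.card_insert_of_notMem hnot]
    refine Finset.card_le_card fun k hk => ?_
    rw [Finset.mem_insert, Finset.mem_filter, Finset.mem_range] at hk
    rw [Finset.mem_filter, Finset.mem_range]
    rcases hk with rfl | ⟨hk, hk'⟩
    · exact ⟨h1, by rw [hsb _ le_rfl, haw]⟩
    · exact ⟨by omega, by rw [hsb _ hk.le, hk']⟩

/-- The radius of a segment with `3 ^ j` vertices. -/
def radius : ℕ → ℤ
  | 0 => 0
  | j + 1 => 3 * radius j + 1

theorem radius_nonneg (j : ℕ) : 0 ≤ radius j := by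
  induction j with
  | zero => exact le_rfl
  | succ j ih => rw [radius]; omega

theorem two_mul_radius_add_one (j : ℕ) : 2 * radius j + 1 = 3 ^ j := by
  induction j with
  | zero => rfl
  | succ j ih => rw [radius, pow_succ, ← ih]; ring

theorem exists_middle_le (T : Fin 3 → ℕ) :
    ∃ e : Equiv.Perm (Fin 3), T (e 1) ≤ T (e 0) ∧ T (e 1) ≤ T (e 2) := by
  obtain ⟨q, hq⟩ := Finite.exists_min T
  exact ⟨Equiv.swap 1 q, by rw [Equiv.swap_apply_left]; exact ⟨hq _, hq _⟩⟩

theorem disjoint_Ioc_block (u d : ℕ) {p q : ℕ} (h : p ≠ q) :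
    Disjoint (Set.Ioc (u + p * d) (u + p * d + d)) (Set.Ioc (u + q * d) (u + q * d + d)) := by
  rw [Set.disjoint_left]
  rintro y ⟨h1, h2⟩ ⟨h3, h4⟩
  rcases h.lt_or_gt with h | h
  · have := Nat.mul_le_mul_right d (Nat.succ_le_of_lt h)
    rw [Nat.succ_mul] at this
    omega
  · have := Nat.mul_le_mul_right d (Nat.succ_le_of_lt h)
    rw [Nat.succ_mul] at this
    omega

/-- Every `3 ^ j` consecutive IDs can be arranged to form a segment of level `j`. -/
theorem Algorithm.exists_isSegment (t j u : ℕ) : ∃ s T, A.IsSegment t j (radius j) s T ∧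
    Set.InjOn s (Set.Icc (-radius j) (radius j)) ∧
    Set.MapsTo s (Set.Icc (-radius j) (radius j)) (Set.Ioc u (u + 3 ^ j)) := by
  induction j generalizing u with
  | zero =>
    obtain ⟨T, hT⟩ := A.exists_isSegment_zero t fun _ => u + 1
    refine ⟨_, T, hT, fun m hm n hn _ => ?_, fun m _ => by simp⟩
    simp only [radius, neg_zero, Set.Icc_self, Set.mem_singleton_iff] at hm hn
    rw [hm, hn]
  | succ j ih =>
    choose s T hs hinj hmaps using fun p : Fin 3 => ih (u + p.val * 3 ^ j)
    obtain ⟨e, h1, h2⟩ := exists_middle_le T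
    obtain ⟨T', hT'⟩ := (hs (e 0)).concat (radius_nonneg j) (hs (e 1)) (hs (e 2)) h1 h2
    have hsub : ∀ p : Fin 3, Set.MapsTo (s p) (Set.Icc (-radius j) (radius j))
        (Set.Ioc u (u + 3 ^ (j + 1))) := fun p m hm => by
      have h := hmaps p hm
      have hp : p.val * 3 ^ j ≤ 2 * 3 ^ j := Nat.mul_le_mul_right _ (by omega)
      rw [Set.mem_Ioc] at h ⊢
      rw [pow_succ]
      omega
    refine ⟨_, T', hT', ?_, mapsTo_concat (hsub _) (hsub _) (hsub _)⟩
    refine injOn_concat (S := fun p => Set.Ioc (u + (e p).val * 3 ^ j) (u + (e p).val * 3 ^ j + 3 ^ j))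
      ?_ (hinj _) (hinj _) (hinj _) (hmaps _) (hmaps _) (hmaps _)
    intro p q hpq
    exact disjoint_Ioc_block u (3 ^ j) fun h => hpq (e.injective (Fin.ext h))

end Line

/-! ### Transfer from the path to the cycle -/

section Cycle

variable {n : ℕ} (hn : 3 ≤ n)

/-- The covering map from the bi-infinite path to the `n`-vertex cycle. -/
def toCycle (i : ℤ) : Fin n := (finRotate n ^ i) ⟨0, by omega⟩

theorem toCycle_add_one (i : ℤ) : toCycle hn (i + 1) = finRotate n (toCycle hn i) := by
  rw [toCycle, add_comm, zpow_add, zpow_one, Equiv.Perm.mul_apply, toCycle]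

theorem toCycle_sub_one (i : ℤ) : toCycle hn (i - 1) = (finRotate n).symm (toCycle hn i) := by
  rw [Equiv.eq_symm_apply, ← toCycle_add_one, sub_add_cancel]

theorem toCycle_natCast (p : ℕ) (hp : p < n) : toCycle hn p = ⟨p, hp⟩ := by
  induction p with
  | zero => rfl
  | succ p ih =>
    rw [Nat.cast_succ, toCycle_add_one, ih (by omega)]
    obtain ⟨m, rfl⟩ : ∃ m, n = m + 1 := ⟨n - 1, by omega⟩
    exact finRotate_of_lt (by omega)

theorem toCycle_injOn : Set.InjOn (toCycle hn) (Set.Ico 0 (n : ℤ)) := by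
  rintro i ⟨hi, hi'⟩ k ⟨hk, hk'⟩ h
  lift i to ℕ using hi
  lift k to ℕ using hk
  rw [toCycle_natCast hn i (by omega), toCycle_natCast hn k (by omega)] at h
  exact congrArg Nat.cast (congrArg Fin.val h)

theorem finRotate_ne_symm {n : ℕ} (hn : 3 ≤ n) (v : Fin n) : finRotate n v ≠ (finRotate n).symm v := by
  have := (orientedCycle n hn).nodup v
  simpa [orientedCycle] using this

/-- The cycle and the path that covers it have the same executions. -/
theorem state_toCycle (A : Algorithm Λ) (ident : Fin n → ℕ) (k : ℕ) (i : ℤ) :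
    A.state (orientedCycle n hn) ident k (toCycle hn i) =
      A.lineState (ident ∘ toCycle hn) k i := by
  induction k generalizing i with
  | zero => rfl
  | succ k ih =>
    have h0 := ih i
    have h1 := ih (i + 1)
    have h2 := ih (i - 1)
    have e1 : ((orientedCycle n hn).nbrs (toCycle hn (i + 1))).idxOf (toCycle hn i) = 1 := by
      -- Needs `n ≥ 3`: otherwise both ports of the neighbour could lead back to the same vertex and
      -- `idxOf` would return 0.
      have hne : finRotate n (finRotate n (toCycle hn i)) ≠ toCycle hn i := fun h =>
        finRotate_ne_symm hn (finRotate n (toCycle hn i)) (by rw [h, Equiv.symm_apply_apply])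
      change List.idxOf _ [_, _] = 1
      rw [toCycle_add_one, Equiv.symm_apply_apply, List.idxOf_cons_ne _ hne, List.idxOf_cons_self]
    have e2 : ((orientedCycle n hn).nbrs (toCycle hn (i - 1))).idxOf (toCycle hn i) = 0 := by
      change List.idxOf _ [_, _] = 0
      rw [toCycle_sub_one, Equiv.apply_symm_apply, List.idxOf_cons_self]
    have e3 : (orientedCycle n hn).nbrs (toCycle hn i) =
        [toCycle hn (i + 1), toCycle hn (i - 1)] := by
      rw [toCycle_add_one, toCycle_sub_one]; rfl
    rw [Algorithm.state, Algorithm.lineState, e3]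
    simp only [List.map_cons, List.map_nil, h0, h1, h2, e1, e2]

/-- A segment with distinct IDs from `{1, …, N}` occurs under some ID assignment. -/
theorem exists_isIDAssignment_matches {N : ℕ} (hN : n ≤ N) {s : ℤ → ℕ} {r : ℤ}
    (hrn : 2 * r + 1 ≤ n) (hinj : Set.InjOn s (Set.Icc (-r) r))
    (hmaps : Set.MapsTo s (Set.Icc (-r) r) (Set.Icc 1 N)) :
    ∃ ident : Fin n → ℕ, IsIDAssignment N ident ∧ Matches (ident ∘ toCycle hn) r s r := by
  classical
  set f : Fin n → ℕ := fun v => s (v.val - r) with hf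
  set S : Finset (Fin n) := Finset.univ.filter fun v => (v.val : ℤ) ≤ 2 * r with hS
  have hSmem : ∀ v ∈ S, (v.val : ℤ) - r ∈ Set.Icc (-r) r := fun v hv => by
    have : (v.val : ℤ) ≤ 2 * r := by simpa [hS] using hv
    constructor <;> omega
  have hfinj : Set.InjOn f S := fun v hv w hw h => by
    have := hinj (hSmem v hv) (hSmem w hw) h
    exact Fin.ext (by omega)
  have himg : S.image f ⊆ Finset.Icc 1 N := by
    intro y hy
    obtain ⟨v, hv, rfl⟩ := Finset.mem_image.1 hy
    exact Finset.mem_Icc.2 (hmaps (hSmem v hv))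
  -- Enlarge the segment's ID set to exactly `n` IDs, so that the partial assignment on positions
  -- `0, …, 2r` extends to a bijection.
  obtain ⟨B, hB1, hB2, hB3⟩ := Finset.exists_subsuperset_card_eq himg (n := n)
    (Finset.card_image_le.trans (S.card_le_univ.trans (by simp))) (by simpa using hN)
  obtain ⟨g, hg⟩ := Finset.exists_equiv_extend_of_card_eq (t := B) (by simp [hB3]) hB1 hfinj
  refine ⟨fun v => g v, ⟨Subtype.val_injective.comp g.injective, fun v => ?_⟩, fun m h1 h2 => ?_⟩
  · exact Finset.mem_Icc.1 (hB2 (g v).2)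
  · obtain ⟨p, hp⟩ := Int.eq_ofNat_of_zero_le (show 0 ≤ r + m by omega)
    rw [Function.comp_apply, hp, toCycle_natCast hn p (by omega),
      hg _ (by simp only [hS, Finset.mem_filter, Finset.mem_univ, true_and]; omega)]
    simp only [hf]
    congr 1; omega

end Cycle

/-! ### Label monotonicity forces roots -/

section Labels

variable [LinearOrder Λ]

/-- If pointers strictly decrease the labels and `p` points forward, then before a position with
a label that is not smaller there is a position that points in neither direction. -/
theorem exists_no_pointer {ℓ : ℤ → Λ} {fwd bwd : ℤ → Prop}
    (hf : ∀ i, fwd i → ℓ (i + 1) < ℓ i) (hb : ∀ i, bwd i → ℓ (i - 1) < ℓ i) {p q : ℤ}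
    (hpq : p < q) (hp : fwd p) (hle : ℓ p ≤ ℓ q) : ∃ i, p < i ∧ i < q ∧ ¬ fwd i ∧ ¬ bwd i := by
  by_contra! hno
  -- Forward pointers propagate: a backward pointer at `i` next to a forward one at `i - 1` would
  -- make each label smaller than the other.
  have key : ∀ i, p + 1 ≤ i → i ≤ q → fwd (i - 1) ∧ ℓ i < ℓ p := by
    intro i hi
    induction i, hi using Int.leInduction with
    | base => exact fun _ => by rw [add_sub_cancel_right]; exact ⟨hp, hf p hp⟩
    | succ i hi ih =>
      intro hiq
      obtain ⟨h1, h2⟩ := ih (by omega)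
      have h3 : fwd i := by
        by_contra h
        have h4 := hb i (hno i (by omega) (by omega) h)
        have h5 := hf _ h1
        rw [sub_add_cancel] at h5
        exact lt_asymm h4 h5
      rw [add_sub_cancel_right]
      exact ⟨h3, (hf i h3).trans h2⟩
  exact (key q (by omega) le_rfl).2.not_ge hle

/-- Mirror image of `exists_no_pointer` under `i ↦ -i`. -/
theorem exists_no_pointer' {ℓ : ℤ → Λ} {fwd bwd : ℤ → Prop}
    (hf : ∀ i, fwd i → ℓ (i + 1) < ℓ i) (hb : ∀ i, bwd i → ℓ (i - 1) < ℓ i) {p q : ℤ}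
    (hpq : p < q) (hq : bwd q) (hle : ℓ q ≤ ℓ p) : ∃ i, p < i ∧ i < q ∧ ¬ fwd i ∧ ¬ bwd i := by
  obtain ⟨i, h1, h2, h3, h4⟩ := exists_no_pointer (ℓ := fun i => ℓ (-i))
    (fwd := fun i => bwd (-i)) (bwd := fun i => fwd (-i)) (p := -q) (q := -p)
    (fun i hi => by have := hb _ hi; rwa [← neg_add'] at this)
    (fun i hi => by have := hf _ hi; rwa [neg_sub, sub_eq_neg_add])
    (by omega) (by rwa [neg_neg]) (by simpa only [neg_neg] using hle)
  exact ⟨-i, by omega, by omega, h4, h3⟩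

end Labels


/-! ### Context-free outputs are contradictory; the lower bound -/

section Main

variable {n : ℕ} (hn : 3 ≤ n)

/-- A valid output on the cycle, unrolled to the path. -/
structure LineDLT [LinearOrder Λ] (n : ℕ) (o : ℤ → DLTOutput Λ) : Prop where
  cases : ∀ i, (o i).parent = none ∨ (∃ l, (o i).parent = some (0, l)) ∨
    ∃ l, (o i).parent = some (1, l)
  fwd : ∀ i, (∃ l, (o i).parent = some (0, l)) → (o (i + 1)).label < (o i).label
  bwd : ∀ i, (∃ l, (o i).parent = some (1, l)) → (o (i - 1)).label < (o i).label
  root : ∀ i ∈ Set.Ico 0 (n : ℤ), ∀ k ∈ Set.Ico 0 (n : ℤ),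
    (o i).parent = none → (o k).parent = none → i = k

theorem IsDLT.line [LinearOrder Λ] {out : Fin n → DLTOutput Λ}
    (h : IsDLT (orientedCycle n hn) out) : LineDLT n (out ∘ toCycle hn) where
  cases i := by
    rcases hp : (out (toCycle hn i)).parent with _ | ⟨p, l⟩
    · exact Or.inl hp
    · have hlt : p < 2 := h.port_valid _ _ hp
      interval_cases p
      · exact Or.inr (Or.inl ⟨l, hp⟩)
      · exact Or.inr (Or.inr ⟨l, hp⟩)
  fwd i := by
    rintro ⟨l, hl⟩
    rw [Function.comp_apply] at hl
    refine h.label_lt _ _ ?_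
    rw [parentOf, hl, toCycle_add_one]
    rfl
  bwd i := by
    rintro ⟨l, hl⟩
    rw [Function.comp_apply] at hl
    refine h.label_lt _ _ ?_
    rw [parentOf, hl, toCycle_sub_one]
    rfl
  root i hi k hk h1 h2 := toCycle_injOn hn hi hk (h.root.unique h1 h2)

theorem exists_three_sorted {ι : Type*} [LinearOrder Λ] (F : Finset ι) (hF : 3 ≤ F.card)
    (L : ι → Λ) : ∃ a ∈ F, ∃ b ∈ F, ∃ c ∈ F, a ≠ b ∧ a ≠ c ∧ b ≠ c ∧ L a ≤ L b ∧ L b ≤ L c := by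
  obtain ⟨a, b, c, ha, hb, hc, hab, hac, hbc⟩ := Finset.two_lt_card_iff.1 hF
  rcases le_total (L a) (L b) with h1 | h1 <;> rcases le_total (L b) (L c) with h2 | h2 <;>
    rcases le_total (L a) (L c) with h3 | h3
  · exact ⟨a, ha, b, hb, c, hc, hab, hac, hbc, h1, h2⟩
  · exact ⟨a, ha, b, hb, c, hc, hab, hac, hbc, h1, h2⟩
  · exact ⟨a, ha, c, hc, b, hb, hac, hab, hbc.symm, h3, h2⟩
  · exact ⟨c, hc, a, ha, b, hb, hac.symm, hbc.symm, hab, h3, h1⟩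
  · exact ⟨b, hb, a, ha, c, hc, hab.symm, hbc, hac, h1, h3⟩
  · exact ⟨b, hb, c, hc, a, ha, hbc, hab.symm, hac.symm, h2, h3⟩
  · exact ⟨c, hc, b, hb, a, ha, hbc.symm, hac.symm, hab.symm, h2, h1⟩
  · exact ⟨c, hc, b, hb, a, ha, hbc.symm, hac.symm, hab.symm, h2, h1⟩

/-- There are no six outputs such that any three of them, in any order, occur in this order on
a cycle with valid outputs. -/
theorem not_forall_exists_lineDLT [LinearOrder Λ] (n : ℕ) (out : Fin 6 → DLTOutput Λ)
    (h : ∀ a b c : Fin 6, a ≠ b → a ≠ c → b ≠ c → ∃ o : ℤ → DLTOutput Λ, LineDLT n o ∧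
      ∃ p q w : ℤ, 0 ≤ p ∧ p < q ∧ q < w ∧ w < n ∧ o p = out a ∧ o q = out b ∧ o w = out c) :
    False := by
  classical
  set Z := Finset.univ.filter fun a => (out a).parent = none with hZ
  set F := Finset.univ.filter fun a => ∃ l, (out a).parent = some (0, l) with hF
  set B := Finset.univ.filter fun a => ∃ l, (out a).parent = some (1, l) with hB
  have third : ∀ a b : Fin 6, ∃ c, a ≠ c ∧ b ≠ c := by decide
  have hZcard : Z.card ≤ 1 := by
    refine Finset.card_le_one.2 fun a ha b hb => ?_
    by_contra hab
    obtain ⟨c, hac, hbc⟩ := third a b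
    obtain ⟨o, ho, p, q, w, h0, h1, h2, h3, e1, e2, -⟩ := h a b c hab hac hbc
    have := ho.root p ⟨h0, by omega⟩ q ⟨by omega, by omega⟩
      (by rw [e1]; exact (Finset.mem_filter.1 ha).2) (by rw [e2]; exact (Finset.mem_filter.1 hb).2)
    omega
  have hcover : Finset.univ ⊆ Z ∪ (F ∪ B) := by
    intro a _
    obtain ⟨b, hab, -⟩ := third a a
    obtain ⟨c, hac, hbc⟩ := third a b
    obtain ⟨o, ho, p, q, w, -, -, -, -, e1, -, -⟩ := h a b c hab hac hbc
    have := ho.cases p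
    rw [e1] at this
    simpa [hZ, hF, hB] using this
  have hcard := (Finset.card_le_card hcover).trans
    ((Finset.card_union_le _ _).trans (Nat.add_le_add_left (Finset.card_union_le _ _) _))
  rw [Finset.card_univ, Fintype.card_fin] at hcard
  have roots : ∀ {o : ℤ → DLTOutput Λ} (_ : LineDLT n o) {p q w : ℤ} (_ : 0 ≤ p) (_ : w < n)
      (_ : ∃ i, p < i ∧ i < q ∧ ¬ (∃ l, (o i).parent = some (0, l)) ∧
        ¬ ∃ l, (o i).parent = some (1, l))
      (_ : ∃ i, q < i ∧ i < w ∧ ¬ (∃ l, (o i).parent = some (0, l)) ∧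
        ¬ ∃ l, (o i).parent = some (1, l)), False := by
    rintro o ho p q w hp hw ⟨i, h1, h2, h3, h4⟩ ⟨k, h5, h6, h7, h8⟩
    have hi := (ho.cases i).resolve_right (not_or.2 ⟨h3, h4⟩)
    have hk := (ho.cases k).resolve_right (not_or.2 ⟨h7, h8⟩)
    have := ho.root i ⟨by omega, by omega⟩ k ⟨by omega, by omega⟩ hi hk
    omega
  -- Pigeonhole: six outputs with at most one root leave five pointers in two directions.
  rcases (show 3 ≤ F.card ∨ 3 ≤ B.card by omega) with hc | hc
  · obtain ⟨a, ha, b, hb, c, -, hab, hac, hbc, h1, h2⟩ :=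
      exists_three_sorted F hc fun a => (out a).label
    obtain ⟨o, ho, p, q, w, hp, hpq, hqw, hw, e1, e2, e3⟩ := h a b c hab hac hbc
    rw [hF, Finset.mem_filter] at ha hb
    rw [← e1] at ha h1
    rw [← e2] at hb h1 h2
    rw [← e3] at h2
    exact roots ho hp hw
      (exists_no_pointer (ℓ := fun i => (o i).label) ho.fwd ho.bwd hpq ha.2 h1)
      (exists_no_pointer (ℓ := fun i => (o i).label) ho.fwd ho.bwd hqw hb.2 h2)
  · obtain ⟨c, hc, b, hb, a, -, hbc, hac, hab, h2, h1⟩ :=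
      exists_three_sorted B hc fun a => (out a).label
    obtain ⟨o, ho, p, q, w, hp, hpq, hqw, hw, e1, e2, e3⟩ := h a b c hab.symm hac.symm hbc.symm
    rw [hB, Finset.mem_filter] at hb hc
    rw [← e1] at h1
    rw [← e2] at hb h1 h2
    rw [← e3] at hc h2
    exact roots ho hp hw
      (exists_no_pointer' (ℓ := fun i => (o i).label) ho.fwd ho.bwd hpq hb.2 h1)
      (exists_no_pointer' (ℓ := fun i => (o i).label) ho.fwd ho.bwd hqw hc.2 h2)

/-- A segment that is not determined up to the end forces `j + 1` awake rounds. -/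
theorem Algorithm.IsSegment.lt_awakeComplexity {A : Algorithm Λ} {t j T : ℕ} {r : ℤ}
    {s : ℤ → ℕ} (h : A.IsSegment t j r s T) (hT : T ≠ t) {ident : Fin n → ℕ} {i : ℤ}
    (hm : Matches (ident ∘ toCycle hn) i s r) :
    j < A.awakeComplexity (orientedCycle n hn) ident t := by
  obtain ⟨haw, hcard⟩ := h.awake.resolve_left hT
  have hlt := lt_of_le_of_ne h.le hT
  refine lt_of_lt_of_le ?_ (Finset.le_sup (Finset.mem_univ (toCycle hn i)))
  refine (Nat.lt_succ_of_le hcard).trans_le ?_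
  have hnot : T ∉ (Finset.range T).filter
      fun k => A.awake (A.lineState s k 0) k = true := by simp
  rw [Nat.succ_eq_add_one, ← Finset.card_insert_of_notMem hnot, awakeRounds]
  refine Finset.card_le_card fun k hk => ?_
  rw [Finset.mem_insert, Finset.mem_filter, Finset.mem_range] at hk
  rw [Finset.mem_filter, Finset.mem_range, state_toCycle]
  rcases hk with rfl | ⟨hk, hk'⟩
  · exact ⟨hlt, by rw [h.det _ _ hm _ le_rfl, haw]⟩
  · exact ⟨by omega, by rw [h.det _ _ hm _ hk.le, hk']⟩

/-- `hjN` supplies IDs for six disjoint segments; `hjn` lets three of them fit on the cycle at once.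
-/
theorem Algorithm.SolvesDLT.exists_lt_awakeComplexity [LinearOrder Λ] {A : Algorithm Λ}
    {N t : ℕ} (hA : A.SolvesDLT (orientedCycle n hn) N t) (j : ℕ) (hnN : n ≤ N)
    (hjn : 3 * 3 ^ j ≤ n) (hjN : 6 * 3 ^ j ≤ N) :
    ∃ ident : Fin n → ℕ, IsIDAssignment N ident ∧
      j < A.awakeComplexity (orientedCycle n hn) ident t := by
  by_contra! hno
  have hr := radius_nonneg j
  have hlen : 2 * radius j + 1 = ((3 ^ j : ℕ) : ℤ) := by
    rw [two_mul_radius_add_one]; push_cast; rfl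
  choose s T hs hinj hblock using fun p : Fin 6 => A.exists_isSegment t j (0 + p.val * 3 ^ j)
  have hmaps : ∀ p, Set.MapsTo (s p) (Set.Icc (-radius j) (radius j)) (Set.Icc 1 N) := by
    intro p m hm
    have h := hblock p hm
    have hp : p.val * 3 ^ j ≤ 5 * 3 ^ j := Nat.mul_le_mul_right _ (by omega)
    rw [Set.mem_Ioc] at h
    exact ⟨by omega, by omega⟩
  have hT : ∀ p, T p = t := by
    intro p
    by_contra hne
    obtain ⟨ident, hid, hm⟩ :=
      exists_isIDAssignment_matches hn hnN (by omega) (hinj p) (hmaps p)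
    exact ((hs p).lt_awakeComplexity hn hne hm).not_ge (hno ident hid)
  refine not_forall_exists_lineDLT n (fun p => A.output (A.lineState (s p) t 0)) ?_
  intro a b c hab hac hbc
  obtain ⟨ident, hid, hm⟩ := exists_isIDAssignment_matches hn hnN
    (s := concat (radius j) (s a) (s b) (s c)) (r := 3 * radius j + 1) (by omega)
    (injOn_concat (S := fun p => Set.Ioc (0 + (![a, b, c] p).val * 3 ^ j)
        (0 + (![a, b, c] p).val * 3 ^ j + 3 ^ j))
      (fun p q hpq => disjoint_Ioc_block 0 (3 ^ j) fun h => hpq (by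
        have h := Fin.ext h
        fin_cases p <;> fin_cases q <;> simp_all))
      (hinj _) (hinj _) (hinj _) (hblock _) (hblock _) (hblock _))
    (mapsTo_concat (hmaps _) (hmaps _) (hmaps _))
  -- The three consecutive blocks of length `2 * radius j + 1` start at position 0; these are their
  -- centres.
  refine ⟨_, (hA ident hid).line, radius j, 3 * radius j + 1, 5 * radius j + 2,
    hr, by omega, by omega, by omega, ?_, ?_, ?_⟩
  all_goals rw [Function.comp_apply, state_toCycle]
  · rw [← (hs a).det _ _ hm.left t (hT a).ge]
    congr 2; ring
  · rw [← (hs b).det _ _ hm.middle t (hT b).ge]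
  · rw [← (hs c).det _ _ hm.right t (hT c).ge]
    congr 2; ring

/-- Every `n ≥ 3` is `18 * 3 ^ j` up to a constant factor, with room for three segments. -/
theorem exists_level {n : ℕ} (hn : 3 ≤ n) :
    ∃ j, 3 * 3 ^ j ≤ n ∧ (j = 0 ∨ 6 * 3 ^ j ≤ n) ∧ n < 18 * 3 ^ j := by
  by_cases h : n < 18
  · exact ⟨0, by omega, Or.inl rfl, by omega⟩
  · have h0 : n / 6 ≠ 0 := by omega
    have h1 := Nat.pow_log_le_self 3 h0
    have h2 := Nat.lt_pow_succ_log_self (b := 3) (by norm_num) (n / 6)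
    rw [pow_succ] at h2
    exact ⟨Nat.log 3 (n / 6), by omega, Or.inr (by omega), by omega⟩

/-- Since `18 * 3 ^ j ≤ 18 ^ (j + 1)` and `18 < e ^ 3`, each level accounts for at most 3 in `log
n`. -/
theorem log_le_of_lt {n j : ℕ} (hn : 3 ≤ n) (h : n < 18 * 3 ^ j) :
    1 / 3 * Real.log n ≤ (j + 1 : ℕ) := by
  have h18 : Real.log 18 ≤ 3 := by
    rw [Real.log_le_iff_le_exp (by norm_num), show (3 : ℝ) = (3 : ℕ) * 1 by norm_num,
      Real.exp_nat_mul]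
    refine le_trans ?_ (pow_le_pow_left₀ (by norm_num) Real.exp_one_gt_d9.le 3)
    norm_num
  have hle : (n : ℝ) ≤ 18 ^ (j + 1) := by
    have : n ≤ 18 ^ (j + 1) := h.le.trans (by
      rw [pow_succ, mul_comm]
      exact Nat.mul_le_mul_right _ (Nat.pow_le_pow_left (by norm_num) j))
    exact_mod_cast this
  have := Real.log_le_log (by positivity) hle
  rw [Real.log_pow] at this
  have h3 := mul_le_mul_of_nonneg_left h18 (Nat.cast_nonneg (α := ℝ) (j + 1))
  linarith

end Main

end SleepingModel

theorem mainTheorem3 :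
    ∃ c : ℝ, 0 < c ∧ ∃ R : ℕ → ℕ, ∀ (t n N : ℕ) (hn : 3 ≤ n), n ≤ N → R t ≤ N →
      ∀ (Λ : Type) [LinearOrder Λ] (A : SleepingModel.Algorithm Λ),
        A.SolvesDLT (SleepingModel.orientedCycle n hn) N t →
          ∃ ident : Fin n → ℕ, SleepingModel.IsIDAssignment N ident ∧
            c * Real.log n ≤
              (A.awakeComplexity (SleepingModel.orientedCycle n hn) ident t : ℝ) := by
  -- A constant `R` suffices: six IDs are needed at level `j = 0`, and at the other levels `6 * 3 ^
  -- j ≤ n ≤ N`.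
  refine ⟨1 / 3, by norm_num, fun _ => 6, fun t n N hn hnN hN Λ _ A hA => ?_⟩
  obtain ⟨j, h1, h2, h3⟩ := SleepingModel.exists_level hn
  obtain ⟨ident, hid, hlt⟩ := hA.exists_lt_awakeComplexity hn j hnN h1 (by
    rcases h2 with rfl | h2
    · simpa using hN
    · exact h2.trans hnN)
  exact ⟨ident, hid, (SleepingModel.log_le_of_lt hn h3).trans (by exact_mod_cast hlt)⟩
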